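/- Let $A$ be a commutative ring, $n\in\mathbb N$, $x=(x_1,\dots,x_n)$ and $T=(T_1,\dots,T_n)$ tuples of indeterminates, and let $F:A[x]\to A[x]$ be an $A$-algebra endomorphism. Put $f_j:=F(x_j)$ and suppose that $f_j(0)=0$ for all $j$ and that the determinant of the Jacobian matrix $(\partial f_i/\partial x_j)_{i,j}$ is a unit of $A[x]$. A ($n$-variate) higher derivation on a ring $R$ is a ring homomorphism $\theta:R\to R[[T]]$ with $\theta(r)|_{T=0}=r$ for all $r\in R$; write $\theta(r)=\sum_{\mu\in\mathbb N^n}\theta^{(\mu)}(r)T^\mu$. Give $A[[x]]$ the $(x)$-adic topology and $A[[x]][[T]]$ the $(x,T)$-adic topology. Then: 1. There is exactly one higher derivation $\theta_f:A[x]\to A[x][[T]]$ on $A[x]$ that extends the higher derivation with respect to $f=(f_1,\dots,f_n)$ on $A[f_1,\dots,f_n]$, i.e. that satisfies $\theta_f(p(f))=p(f+T)$ for every polynomial $p$ in $n$ variables over $A$ (equivalently, $\theta_f$ is $A$-linear and $\theta_f(f_i)=f_i+T_i$ for all $i$). It extends uniquely to a continuous ring homomorphism $\theta_f:A[[x]]\to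 A[[x]][[T]]$, which is again a higher derivation. 2. $F$ extends uniquely to a continuous ring homomorphism $F:A[[x]]\to A[[x]]$, and this extension is an $A$-algebra automorphism. 3. The inverse $G$ of $F:A[[x]]\to A[[x]]$ is given, for all $h\in A[[x]]$, by $$G(h)=\bigl(\theta_f(h)|_{x=0}\bigr)\big|_{T=x}=\sum_{\mu\in\mathbb N^n}\theta_f^{(\mu)}(h)\big|_{x=0}\,x^\mu .$$ -/

import Mathlib

open scoped MvPowerSeries.WithPiTopology

/-- A `d`-variate higher derivation on `R`: a ring homomorphism `θ : R → R[[T₁, …, T_d]]`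
such that `θ(r)|_{T = 0} = r` for all `r`. Its component `θ^{(μ)} : R → R` is
`r ↦ MvPowerSeries.coeff μ (θ r)`. -/
def IsHigherDerivation {R : Type*} [CommRing R] {d : ℕ}
    (θ : R →+* MvPowerSeries (Fin d) R) : Prop :=
  ∀ r : R, MvPowerSeries.constantCoeff (θ r) = r

/-- The Jacobian matrix `(∂f_i / ∂x_j)_{i,j}`. -/
noncomputable def jacobianMatrix {A : Type*} [CommRing A] {n : ℕ}
    (f : Fin n → MvPolynomial (Fin n) A) :
    Matrix (Fin n) (Fin n) (MvPolynomial (Fin n) A) :=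
  Matrix.of fun i j => MvPolynomial.pderiv j (f i)

/-- `θ` is a higher derivation on `A[x]` that extends the higher derivation with respect to
`f = (f₁, …, f_n)` on the subring `A[f₁, …, f_n]`. The latter is the `A`-algebra homomorphism
`A[f] → A[f][[T]]` with `f_i ↦ f_i + T_i`, i.e. it maps `p(f)` to `p(f + T)` for every
polynomial `p` with coefficients in `A`. -/
def ExtendsHigherDerivationWrt {A : Type*} [CommRing A] {n : ℕ}
    (f : Fin n → MvPolynomial (Fin n) A)
    (θ : MvPolynomial (Fin n) A →+* MvPowerSeries (Fin n) (MvPolynomial (Fin n) A)) : Prop :=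
  IsHigherDerivation θ ∧
    ∀ p : MvPolynomial (Fin n) A,
      θ (MvPolynomial.aeval f p) =
        MvPolynomial.aeval
          (fun i => (MvPowerSeries.C (f i) + MvPowerSeries.X i :
            MvPowerSeries (Fin n) (MvPolynomial (Fin n) A))) p

/-- `Θ : A[[x]] → A[[x]][[T]]` is a continuous ring homomorphism extending
`θ : A[x] → A[x][[T]]`. For discrete `A`, the product topology on `A[[x]]` is the `(x)`-adic one
and the topology on `A[[x]][[T]]` is the `(x, T)`-adic one. -/
def IsContinuousExtensionHD {A : Type*} [CommRing A] [TopologicalSpace A] {n : ℕ}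
    (θ : MvPolynomial (Fin n) A →+* MvPowerSeries (Fin n) (MvPolynomial (Fin n) A))
    (Θ : MvPowerSeries (Fin n) A →+* MvPowerSeries (Fin n) (MvPowerSeries (Fin n) A)) : Prop :=
  Continuous Θ ∧
    ∀ p : MvPolynomial (Fin n) A,
      Θ (p : MvPowerSeries (Fin n) A) =
        MvPowerSeries.map MvPolynomial.coeToMvPowerSeries.ringHom (θ p)

/-- `Φ : A[[x]] → A[[x]]` is a continuous ring homomorphism extending the endomorphism `F` of
`A[x]`. For discrete `A`, the product topology on `A[[x]]` is the `(x)`-adic one. -/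
def IsContinuousExtensionEnd {A : Type*} [CommRing A] [TopologicalSpace A] {n : ℕ}
    (F : MvPolynomial (Fin n) A →ₐ[A] MvPolynomial (Fin n) A)
    (Φ : MvPowerSeries (Fin n) A →+* MvPowerSeries (Fin n) A) : Prop :=
  Continuous Φ ∧
    ∀ p : MvPolynomial (Fin n) A,
      Φ (p : MvPowerSeries (Fin n) A) = (F p : MvPowerSeries (Fin n) A)

/-! Everything rests on a formal inverse function theorem, `bijective_subst`: power series without
constant terms and with invertible linear part `L` can be inverted under substitution. By
`succ_le_order_subst_sub_linear`, `f(a) - f(b) - L(a - b)` has higher order than the known bound for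
`a - b`. This gives uniqueness, and convergence of Newton's iteration with the fixed derivative `L`.

Over `A[x]`, the series `f(x + T) - f(x)` in `T` has the Jacobian matrix as linear part, so `f(x +
y) = f(x) + T` has a unique solution `y` without constant terms, and `θ_f` is `x ↦ x + y`. Over `A`,
the linear part of `f` is the Jacobian at `0`, so `F` extends to an automorphism.

Finally, `F` followed by `θ_f` and `x = 0` sends `p` to `p(f)`, `p(f + T)`, `p(T)`: the identity on
polynomials, hence by density on `A[[x]]`. -/

namespace MvPowerSeries

/-! ### Order estimates for substitution -/

section Order

variable {σ τ ι R : Type*} [CommRing R]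

theorem le_order_sum {s : Finset ι} {f : ι → MvPowerSeries σ R} {k : ℕ∞}
    (h : ∀ i ∈ s, k ≤ (f i).order) : k ≤ (∑ i ∈ s, f i).order :=
  Finset.sum_induction f (fun g => k ≤ g.order)
    (fun _ _ ha hb => (le_min ha hb).trans min_order_le_add) (by simp) h

theorem le_order_mul_left {k : ℕ∞} (f : MvPowerSeries σ R) {g : MvPowerSeries σ R}
    (h : k ≤ g.order) : k ≤ (f * g).order :=
  (h.trans le_add_self).trans le_order_mul

theorem le_order_mulVec [Fintype ι] {k : ℕ∞} (P : Matrix ι ι (MvPowerSeries σ R))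
    {v : ι → MvPowerSeries σ R} (h : ∀ i, k ≤ (v i).order) (i : ι) :
    k ≤ ((P.mulVec v) i).order :=
  le_order_sum fun j _ => le_order_mul_left _ (h j)

theorem mul_sub_mul_eq (x y x' y' : MvPowerSeries σ R) :
    x * y - x' * y' = (x - x') * y + x' * (y - y') := by
  ring

theorem le_order_finsuppProd_sub {k : ℕ∞} {a b : σ → MvPowerSeries τ R}
    (hab : ∀ j, k ≤ (a j - b j).order) (d : σ →₀ ℕ) :
    k ≤ ((d.prod fun s e => a s ^ e) - d.prod fun s e => b s ^ e).order := by
  induction d using Finsupp.induction_linear with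
  | zero => simp
  | add d e hd he =>
    rw [Finsupp.prod_add_index' (by simp) (by simp [pow_add]),
      Finsupp.prod_add_index' (by simp) (by simp [pow_add]),
      mul_sub_mul_eq]
    exact (le_min (by rw [mul_comm]; exact le_order_mul_left _ hd)
      (le_order_mul_left _ he)).trans min_order_le_add
  | single i n =>
    rw [Finsupp.prod_single_index (by simp), Finsupp.prod_single_index (by simp)]
    obtain ⟨c, hc⟩ := sub_dvd_pow_sub_pow (a i) (b i) n
    rw [hc, mul_comm]
    exact le_order_mul_left _ (hab i)

/-- In degree at least two, splitting off one variable leaves a nontrivial monomial. In `(x - x') *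
y + x' * (y - y')` each difference is thus multiplied by a series without constant term, which gains
one order. -/
theorem succ_le_order_finsuppProd_sub {k : ℕ∞} {a b : σ → MvPowerSeries τ R}
    (ha : ∀ j, constantCoeff (a j) = 0) (hb : ∀ j, constantCoeff (b j) = 0)
    (hab : ∀ j, k ≤ (a j - b j).order) {d : σ →₀ ℕ} (hd : 2 ≤ d.degree) :
    k + 1 ≤ ((d.prod fun s e => a s ^ e) - d.prod fun s e => b s ^ e).order := by
  obtain ⟨i, hi⟩ : ∃ i, d i ≠ 0 := by
    by_contra! h
    have : d = 0 := Finsupp.ext h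
    simp [this] at hd
  obtain ⟨d, rfl⟩ : ∃ e, d = Finsupp.single i 1 + e :=
    ⟨d - Finsupp.single i 1, (add_tsub_cancel_of_le 
      (by simpa using Nat.one_le_iff_ne_zero.2 hi)).symm⟩
  obtain ⟨j, hj⟩ : ∃ j, d j ≠ 0 := by
    by_contra! h
    have : d = 0 := Finsupp.ext h
    simp [this] at hd
  rw [Finsupp.prod_add_index' (by simp) (by simp [pow_add]),
    Finsupp.prod_add_index' (by simp) (by simp [pow_add]),
    Finsupp.prod_single_index (by simp), Finsupp.prod_single_index (by simp), pow_one, pow_one]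
  rw [mul_sub_mul_eq]
  have h1 : 1 ≤ (d.prod fun s e => a s ^ e).order := by
    rw [one_le_order_iff_constCoeff_eq_zero, Finsupp.prod, map_prod]
    exact Finset.prod_eq_zero (Finsupp.mem_support_iff.2 hj) (by simp [ha, hj])
  have h2 : 1 ≤ (b i).order := one_le_order_iff_constCoeff_eq_zero.2 (hb i)
  refine (le_min ?_ ?_).trans min_order_le_add
  · exact (add_le_add (hab i) h1).trans le_order_mul
  · rw [add_comm]
    exact (add_le_add h2 (le_order_finsuppProd_sub hab d)).trans le_order_mul

theorem succ_le_order_subst_sub [Finite σ] {k : ℕ} {a b : σ → MvPowerSeries τ R}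
    (ha : ∀ j, constantCoeff (a j) = 0) (hb : ∀ j, constantCoeff (b j) = 0)
    (hab : ∀ j, (k : ℕ∞) ≤ (a j - b j).order) {f : MvPowerSeries σ R} (hf : 2 ≤ f.order) :
    (k + 1 : ℕ) ≤ (subst a f - subst b f).order := by
  refine nat_le_order fun e he => ?_
  rw [map_sub, coeff_subst (hasSubst_of_constantCoeff_zero ha),
    coeff_subst (hasSubst_of_constantCoeff_zero hb), sub_eq_zero]
  refine finsum_congr fun d => ?_
  by_cases hd : 2 ≤ d.degree
  · have := coeff_of_lt_order (d := e) (lt_of_lt_of_le (by exact_mod_cast he)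
      (succ_le_order_finsuppProd_sub ha hb hab hd))
    rw [map_sub, sub_eq_zero] at this
    rw [this]
  · rw [coeff_of_lt_order (lt_of_lt_of_le (by exact_mod_cast not_le.1 hd) hf), zero_smul, zero_smul]

end Order

/-! ### The formal inverse function theorem -/

section Inverse

variable {σ τ R : Type*} [CommRing R]

/-- The matrix of the linear terms of a family of power series. -/
noncomputable def linearMatrix (f : σ → MvPowerSeries σ R) : Matrix σ σ R :=
  Matrix.of fun i j => coeff (Finsupp.single j 1) (f i)

theorem linearMatrix_X [DecidableEq σ] : linearMatrix (X : σ → MvPowerSeries σ R) = 1 := by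
  ext i j
  simp [linearMatrix, coeff_X, Matrix.one_apply, Finsupp.single_left_inj, eq_comm]

variable [Fintype σ]

/-- The terms of degree at least two of a family of power series without constant terms. -/
noncomputable def nonlinearPart (f : σ → MvPowerSeries σ R) (i : σ) : MvPowerSeries σ R :=
  f i - ∑ j, C (linearMatrix f i j) * X j

theorem two_le_order_nonlinearPart {f : σ → MvPowerSeries σ R}
    (hf : ∀ i, constantCoeff (f i) = 0) (i : σ) : 2 ≤ (nonlinearPart f i).order := by
  classical
  refine nat_le_order (n := 2) fun d hd => ?_
  rw [nonlinearPart]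
  obtain h | h : d.degree = 0 ∨ d.degree = 1 := by omega
  · rw [Finsupp.degree_eq_zero_iff] at h
    subst h
    simp [hf]
  · obtain ⟨j, rfl⟩ : d ∈ Set.range (Finsupp.single · 1) := by
      rw [Finsupp.range_single_one]; exact h
    simp [linearMatrix, coeff_X, Finsupp.single_left_inj]

theorem subst_eq_linear_add {f : σ → MvPowerSeries σ R} {a : σ → MvPowerSeries τ R}
    (ha : ∀ j, constantCoeff (a j) = 0) (i : σ) :
    subst a (f i) = ((linearMatrix f).map C).mulVec a i + subst a (nonlinearPart f i) := by
  have ha' := hasSubst_of_constantCoeff_zero ha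
  have : f i = ∑ j, C (linearMatrix f i j) * X j + nonlinearPart f i := by
    rw [nonlinearPart]; ring
  conv_lhs => rw [this]
  rw [← coe_substAlgHom (R := R) ha', map_add, map_sum]
  congr 1
  refine Finset.sum_congr rfl fun j _ => ?_
  rw [map_mul, substAlgHom_X, coe_substAlgHom, subst_C]
  rfl

theorem succ_le_order_subst_sub_linear {f : σ → MvPowerSeries σ R}
    (hf : ∀ i, constantCoeff (f i) = 0) {k : ℕ} {a b : σ → MvPowerSeries τ R}
    (ha : ∀ j, constantCoeff (a j) = 0) (hb : ∀ j, constantCoeff (b j) = 0)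
    (hab : ∀ j, (k : ℕ∞) ≤ (a j - b j).order) (i : σ) :
    (k + 1 : ℕ) ≤
      (subst a (f i) - subst b (f i) - ((linearMatrix f).map C).mulVec (a - b) i).order := by
  convert succ_le_order_subst_sub ha hb hab (two_le_order_nonlinearPart hf i) using 2
  rw [subst_eq_linear_add ha, subst_eq_linear_add hb, Matrix.mulVec_sub, Pi.sub_apply]
  ring

/-- The chain rule at the origin; it makes the linear part of an inverse invertible too. -/
theorem linearMatrix_subst {f : σ → MvPowerSeries σ R} (hf : ∀ i, constantCoeff (f i) = 0)
    {g : σ → MvPowerSeries σ R} (hg : ∀ i, constantCoeff (g i) = 0) :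
    linearMatrix (fun i => subst g (f i)) = linearMatrix f * linearMatrix g := by
  ext i j
  have h2 : 2 ≤ (subst g (nonlinearPart f i)).order := by
    -- Comparison with the zero family, from which `g` differs by order at least one.
    have := succ_le_order_subst_sub (k := 1) hg (b := 0) (by simp)
      (fun j => by simpa [one_le_order_iff_constCoeff_eq_zero] using hg j)
      (two_le_order_nonlinearPart hf i)
    have h0 : subst (0 : σ → MvPowerSeries σ R) (nonlinearPart f i) = 0 := by
      refine subst_zero_of_constantCoeff_zero ?_
      rw [← one_le_order_iff_constCoeff_eq_zero]
      exact le_trans (by norm_num) (two_le_order_nonlinearPart hf i)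
    rwa [h0, sub_zero] at this
  have h3 : coeff (Finsupp.single j 1) (subst g (nonlinearPart f i)) = 0 :=
    coeff_of_lt_order (lt_of_lt_of_le (by simp) h2)
  rw [linearMatrix, Matrix.of_apply, subst_eq_linear_add hg, map_add, h3, add_zero]
  simp [Matrix.mulVec, dotProduct, Matrix.mul_apply, linearMatrix]

variable [DecidableEq σ]

theorem exists_inverse_map_C {P : Matrix σ σ R} (hP : IsUnit P.det) :
    ∃ Q : Matrix σ σ (MvPowerSeries τ R), Q * P.map C = 1 ∧ P.map C * Q = 1 := by
  refine ⟨P⁻¹.map C, ?_, ?_⟩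
  · rw [← Matrix.map_mul, Matrix.nonsing_inv_mul P hP, Matrix.map_one _ (map_zero _) (map_one _)]
  · rw [← Matrix.map_mul, Matrix.mul_nonsing_inv P hP, Matrix.map_one _ (map_zero _) (map_one _)]

/-- If `a - b` has order at least `k`, then `L(a - b)` has order at least `k + 1`, and inverting `L`
carries this bound back to `a - b`. -/
theorem eq_of_forall_subst_eq {f : σ → MvPowerSeries σ R}
    (hf : ∀ i, constantCoeff (f i) = 0) (hdet : IsUnit (linearMatrix f).det)
    {a b : σ → MvPowerSeries τ R}
    (ha : ∀ j, constantCoeff (a j) = 0) (hb : ∀ j, constantCoeff (b j) = 0)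
    (h : ∀ i, subst a (f i) = subst b (f i)) : a = b := by
  obtain ⟨Q, hQ, -⟩ := exists_inverse_map_C (τ := τ) hdet
  have key : ∀ k : ℕ, ∀ j, (k : ℕ∞) ≤ (a j - b j).order := by
    intro k
    induction k with
    | zero => simp
    | succ k ih =>
      intro j
      have h1 : ∀ i, (k + 1 : ℕ) ≤ (((linearMatrix f).map C).mulVec (a - b) i).order := by
        intro i
        have := succ_le_order_subst_sub_linear hf ha hb ih i
        rwa [h i, sub_self, zero_sub, order_neg] at this
      have h2 := le_order_mulVec Q h1 j
      rwa [Matrix.mulVec_mulVec, hQ, Matrix.one_mulVec] at h2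
  funext j
  rw [← sub_eq_zero, ← order_eq_top_iff]
  exact ENat.eq_top_iff_forall_ge.2 fun k => key k j

/-- Iterate `a ↦ a - L⁻¹(f(a) - X)` from `0`; each step raises the order bound on the error by one.
-/
theorem exists_subst_eq_X {f : σ → MvPowerSeries σ R}
    (hf : ∀ i, constantCoeff (f i) = 0) (hdet : IsUnit (linearMatrix f).det) :
    ∃ g : σ → MvPowerSeries σ R, (∀ i, constantCoeff (g i) = 0) ∧ ∀ i, subst g (f i) = X i := by
  obtain ⟨Q, hQ, hQ'⟩ := exists_inverse_map_C (τ := σ) hdet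
  let err : (σ → MvPowerSeries σ R) → σ → MvPowerSeries σ R := fun a i => subst a (f i) - X i
  let next : (σ → MvPowerSeries σ R) → σ → MvPowerSeries σ R := fun a => a - Q.mulVec (err a)
  let s : ℕ → σ → MvPowerSeries σ R := fun k => next^[k] 0
  have hs : ∀ k, s (k + 1) = s k - Q.mulVec (err (s k)) :=
    fun k => Function.iterate_succ_apply' next k 0
  have herr : ∀ a : σ → MvPowerSeries σ R, (∀ i, constantCoeff (a i) = 0) →
      ∀ i, (1 : ℕ) ≤ (err a i).order := by
    intro a ha i
    rw [Nat.cast_one, one_le_order_iff_constCoeff_eq_zero, map_sub, constantCoeff_X, sub_zero]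
    exact constantCoeff_subst_eq_zero (hasSubst_of_constantCoeff_zero ha) ha (hf i)
  have hinv : ∀ k, (∀ i, constantCoeff (s k i) = 0) ∧ ∀ i, (k + 1 : ℕ) ≤ (err (s k) i).order := by
    intro k
    induction k with
    | zero => exact ⟨fun i => by simp [s], herr _ (by simp [s])⟩
    | succ k ih =>
      obtain ⟨h0, h1⟩ := ih
      have hd : ∀ i, (k + 1 : ℕ) ≤ (s (k + 1) i - s k i).order := by
        intro i
        rw [hs, Pi.sub_apply, sub_sub_cancel_left, order_neg]
        exact le_order_mulVec Q h1 i
      have h0' : ∀ i, constantCoeff (s (k + 1) i) = 0 := by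
        intro i
        rw [← sub_add_cancel (s (k + 1) i) (s k i), map_add, h0, add_zero,
          ← one_le_order_iff_constCoeff_eq_zero]
        exact le_trans (by simp) (hd i)
      refine ⟨h0', fun i => ?_⟩
      -- `L` applied to the correction is minus the old error, so the new error is exactly the
      -- nonlinear remainder.
      convert succ_le_order_subst_sub_linear hf h0' h0 hd i using 2
      have : s (k + 1) - s k = - Q.mulVec (err (s k)) := by rw [hs]; abel
      rw [this, Matrix.mulVec_neg, Matrix.mulVec_mulVec, hQ', Matrix.one_mulVec]
      simp only [err, Pi.neg_apply]
      ring
  have hstep : ∀ k i, (k + 1 : ℕ) ≤ (s (k + 1) i - s k i).order := by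
    intro k i
    rw [hs, Pi.sub_apply, sub_sub_cancel_left, order_neg]
    exact le_order_mulVec Q (hinv k).2 i
  have hcoeff : ∀ i (d : σ →₀ ℕ) (m : ℕ), coeff d (s (d.degree + m) i) = coeff d (s d.degree i) := by
    intro i d m
    induction m with
    | zero => rfl
    | succ m ih =>
      rw [← ih, ← sub_eq_zero, ← map_sub]
      refine coeff_of_lt_order (lt_of_lt_of_le ?_ (hstep (d.degree + m) i))
      exact_mod_cast (by omega)
  -- The limit: a coefficient of degree `m` no longer changes from iterate `m` on.
  let g : σ → MvPowerSeries σ R := fun i d => coeff d (s d.degree i)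
  have hg : ∀ i d, coeff d (g i) = coeff d (s d.degree i) := fun i d => rfl
  have hgs : ∀ k i, (k + 1 : ℕ) ≤ (g i - s k i).order := by
    intro k i
    refine nat_le_order fun d hd => ?_
    obtain ⟨m, rfl⟩ := Nat.exists_eq_add_of_le (Nat.lt_succ_iff.1 hd)
    rw [map_sub, hcoeff, hg, sub_self]
  have hg0 : ∀ i, constantCoeff (g i) = 0 := by
    intro i
    rw [← coeff_zero_eq_constantCoeff_apply, hg, coeff_zero_eq_constantCoeff_apply]
    exact (hinv _).1 i
  refine ⟨g, hg0, fun i => ?_⟩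
  rw [← sub_eq_zero, ← order_eq_top_iff]
  refine ENat.eq_top_iff_forall_ge.2 fun k => ?_
  have h1 := succ_le_order_subst_sub_linear hf hg0 (hinv k).1 (hgs k) i
  have h2 := le_order_mulVec ((linearMatrix f).map C) (v := g - s k) (hgs k) i
  have h3 := (hinv k).2 i
  have e : subst g (f i) - X i = (subst g (f i) - subst (s k) (f i) -
      ((linearMatrix f).map C).mulVec (g - s k) i) +
      (((linearMatrix f).map C).mulVec (g - s k) i + err (s k) i) := by
    simp only [err]; ring
  have hk : (k : ℕ∞) ≤ (k + 1 : ℕ) := by simp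
  have hk' : ((k + 1 : ℕ) : ℕ∞) ≤ ((k + 1 + 1 : ℕ) : ℕ∞) := by exact_mod_cast Nat.le_succ _
  rw [e]
  exact hk.trans <| (le_min (hk'.trans h1) ((le_min h2 h3).trans min_order_le_add)).trans
    min_order_le_add

/-- **Formal inverse function theorem**: substituting power series without constant terms whose
linear terms form an invertible matrix is bijective. -/
theorem bijective_subst {f : σ → MvPowerSeries σ R}
    (hf : ∀ i, constantCoeff (f i) = 0) (hdet : IsUnit (linearMatrix f).det) :
    Function.Bijective (subst f : MvPowerSeries σ R → MvPowerSeries σ R) := by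
  -- The `g` obtained satisfies the same hypotheses as `f`, so the claim applies to `g` in turn and
  -- makes `subst g` injective; surjectivity of `subst f` follows.
  have right : ∀ {f : σ → MvPowerSeries σ R}, (∀ i, constantCoeff (f i) = 0) →
      IsUnit (linearMatrix f).det → ∃ g : σ → MvPowerSeries σ R,
      (∀ i, constantCoeff (g i) = 0) ∧ IsUnit (linearMatrix g).det ∧
      Function.LeftInverse (subst g : MvPowerSeries σ R → MvPowerSeries σ R)
        (subst f : MvPowerSeries σ R → MvPowerSeries σ R) := by
    intro f hf hdet
    obtain ⟨g, hg, hfg⟩ := exists_subst_eq_X hf hdet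
    refine ⟨g, hg, ?_, fun h => ?_⟩
    · have h := linearMatrix_subst hf hg
      rw [funext hfg, linearMatrix_X] at h
      refine IsUnit.of_mul_eq_one_right (linearMatrix f).det ?_
      rw [← Matrix.det_mul, ← h, Matrix.det_one]
    · rw [subst_comp_subst_apply (hasSubst_of_constantCoeff_zero hf)
        (hasSubst_of_constantCoeff_zero hg), funext hfg]
      exact congrFun subst_self h
  obtain ⟨g, hg, hgdet, hgf⟩ := right hf hdet
  obtain ⟨h, -, -, hhg⟩ := right hg hgdet
  refine ⟨hgf.injective, fun y => ⟨subst g y, hhg.injective ?_⟩⟩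
  rw [hgf]

end Inverse

end MvPowerSeries

/-! ### Taylor expansion of polynomials and the Jacobian matrix -/

namespace MvPowerSeries

theorem coeff_single_one_mul {σ R : Type*} [CommRing R] (j : σ) (f g : MvPowerSeries σ R) :
    coeff (Finsupp.single j 1) (f * g) =
      coeff (Finsupp.single j 1) f * constantCoeff g +
        constantCoeff f * coeff (Finsupp.single j 1) g := by
  classical
  rw [coeff_mul, Finsupp.antidiagonal_single, Finset.sum_map]
  simp [Finset.Nat.antidiagonal_succ, add_comm]

end MvPowerSeries

namespace MvPolynomial

variable {σ A : Type*} [CommRing A]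

theorem algebraMap_mvPowerSeries_apply (r : A) :
    algebraMap A (MvPowerSeries σ (MvPolynomial σ A)) r = MvPowerSeries.C (C r) := by
  rw [MvPowerSeries.algebraMap_apply, algebraMap_eq]

theorem constantCoeff_aeval_C_X_add {y : σ → MvPowerSeries σ (MvPolynomial σ A)}
    (hy : ∀ i, MvPowerSeries.constantCoeff (y i) = 0) (p : MvPolynomial σ A) :
    MvPowerSeries.constantCoeff (aeval (fun i => MvPowerSeries.C (X i) + y i) p) = p := by
  induction p using MvPolynomial.induction_on with
  | C a => simp [algebraMap_mvPowerSeries_apply]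
  | add p q hp hq => simp only [map_add, hp, hq]
  | mul_X p i hp => simp [hp, hy]

theorem coeff_single_aeval_C_X_add_X (p : MvPolynomial σ A) (j : σ) :
    MvPowerSeries.coeff (Finsupp.single j 1)
      (aeval (fun i => (MvPowerSeries.C (X i) + MvPowerSeries.X i :
        MvPowerSeries σ (MvPolynomial σ A))) p) = pderiv j p := by
  classical
  induction p using MvPolynomial.induction_on with
  | C a => simp [algebraMap_mvPowerSeries_apply, MvPowerSeries.coeff_C]
  | add p q hp hq => simp only [map_add, hp, hq]
  | mul_X p i hp =>
    rw [map_mul, MvPowerSeries.coeff_single_one_mul, hp,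
      constantCoeff_aeval_C_X_add (fun i => MvPowerSeries.constantCoeff_X i) p, aeval_X,
      Derivation.leibniz]
    simp [MvPowerSeries.coeff_C, MvPowerSeries.coeff_X, pderiv_X, Finsupp.single_left_inj,
      Pi.single_apply, eq_comm, mul_comm, add_comm]

theorem subst_aeval_C_X_add_X [Finite σ] {y : σ → MvPowerSeries σ (MvPolynomial σ A)}
    (hy : ∀ i, MvPowerSeries.constantCoeff (y i) = 0) (p : MvPolynomial σ A) :
    MvPowerSeries.subst y (aeval (fun i => (MvPowerSeries.C (X i) + MvPowerSeries.X i :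
        MvPowerSeries σ (MvPolynomial σ A))) p) =
      aeval (fun i => MvPowerSeries.C (X i) + y i) p := by
  have h := MvPowerSeries.hasSubst_of_constantCoeff_zero hy
  rw [← MvPowerSeries.coe_substAlgHom h]
  induction p using MvPolynomial.induction_on with
  | C a =>
    simp only [algHom_C, algebraMap_mvPowerSeries_apply, MvPowerSeries.coe_substAlgHom,
      MvPowerSeries.subst_C]
  | add p q hp hq => simp only [map_add, hp, hq]
  | mul_X p i hp =>
    simp only [map_mul, hp, aeval_X, map_add, MvPowerSeries.substAlgHom_X]
    rw [MvPowerSeries.coe_substAlgHom, MvPowerSeries.subst_C]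

/-- The difference `f (x + T) - f (x)` as a power series in `T` over the polynomials in `x`. -/
noncomputable def increment (f : σ → MvPolynomial σ A) (i : σ) :
    MvPowerSeries σ (MvPolynomial σ A) :=
  aeval (fun i => (MvPowerSeries.C (X i) + MvPowerSeries.X i :
    MvPowerSeries σ (MvPolynomial σ A))) (f i) - MvPowerSeries.C (f i)

theorem constantCoeff_increment (f : σ → MvPolynomial σ A) (i : σ) :
    MvPowerSeries.constantCoeff (increment f i) = 0 := by
  rw [increment, map_sub, constantCoeff_aeval_C_X_add fun i => MvPowerSeries.constantCoeff_X i,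
    MvPowerSeries.constantCoeff_C, sub_self]

theorem linearMatrix_increment (f : σ → MvPolynomial σ A) :
    MvPowerSeries.linearMatrix (increment f) = Matrix.of fun i j => pderiv j (f i) := by
  classical
  ext1 i j
  simp [MvPowerSeries.linearMatrix, increment, coeff_single_aeval_C_X_add_X,
    MvPowerSeries.coeff_C]

theorem subst_increment [Finite σ] (f : σ → MvPolynomial σ A)
    {y : σ → MvPowerSeries σ (MvPolynomial σ A)}
    (hy : ∀ i, MvPowerSeries.constantCoeff (y i) = 0) (i : σ) :
    MvPowerSeries.subst y (increment f i) =
      aeval (fun i => MvPowerSeries.C (X i) + y i) (f i) - MvPowerSeries.C (f i) := by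
  rw [increment, MvPowerSeries.subst_sub (MvPowerSeries.hasSubst_of_constantCoeff_zero hy),
    subst_aeval_C_X_add_X hy, MvPowerSeries.subst_C]

theorem linearMatrix_coe (f : σ → MvPolynomial σ A) :
    MvPowerSeries.linearMatrix (fun i => (f i : MvPowerSeries σ A)) =
      (Matrix.of fun i j => pderiv j (f i)).map constantCoeff := by
  ext i j
  rw [MvPowerSeries.linearMatrix, Matrix.of_apply, coeff_coe, Matrix.map_apply, Matrix.of_apply,
    constantCoeff_eq, coeff_pderiv]
  simp

end MvPolynomial

/-! ### The higher derivation on polynomials -/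

theorem exists_unique_extendsHigherDerivationWrt {A : Type*} [CommRing A] {n : ℕ}
    (f : Fin n → MvPolynomial (Fin n) A) (hJ : IsUnit (jacobianMatrix f).det) :
    ∃ u : Fin n → MvPowerSeries (Fin n) (MvPolynomial (Fin n) A),
      ExtendsHigherDerivationWrt f (MvPolynomial.aeval u :
        MvPolynomial (Fin n) A →ₐ[A] MvPowerSeries (Fin n) (MvPolynomial (Fin n) A)).toRingHom ∧
      ∀ θ, ExtendsHigherDerivationWrt f θ → θ = (MvPolynomial.aeval u :
        MvPolynomial (Fin n) A →ₐ[A]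
          MvPowerSeries (Fin n) (MvPolynomial (Fin n) A)).toRingHom := by
  have hJ' : IsUnit (MvPowerSeries.linearMatrix (MvPolynomial.increment f)).det := by
    rwa [MvPolynomial.linearMatrix_increment]
  have h0 := MvPolynomial.constantCoeff_increment f
  obtain ⟨y, hy, hfy⟩ := MvPowerSeries.exists_subst_eq_X h0 hJ'
  have hyf : ∀ i, MvPolynomial.aeval (fun i => MvPowerSeries.C (MvPolynomial.X i) + y i) (f i) =
      MvPowerSeries.C (f i) + MvPowerSeries.X i := by
    intro i
    rw [← hfy i, MvPolynomial.subst_increment f hy, add_sub_cancel]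
  refine ⟨fun i => MvPowerSeries.C (MvPolynomial.X i) + y i,
    ⟨fun p => MvPolynomial.constantCoeff_aeval_C_X_add hy p, fun p => ?_⟩, ?_⟩
  · change MvPolynomial.aeval _ (MvPolynomial.aeval f p) = _
    rw [← funext hyf, ← AlgHom.comp_apply, MvPolynomial.comp_aeval]
  · rintro θ ⟨hθ, hθf⟩
    -- Constant `p` in the extension property forces `A`-linearity, so `θ` is determined by the
    -- increments `z` of the variables.
    have hC : ∀ r : A, θ (MvPolynomial.C r) = MvPowerSeries.C (MvPolynomial.C r) := fun r => by
      simpa [MvPolynomial.algebraMap_mvPowerSeries_apply] using hθf (MvPolynomial.C r)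
    let z : Fin n → MvPowerSeries (Fin n) (MvPolynomial (Fin n) A) := fun i =>
      θ (MvPolynomial.X i) - MvPowerSeries.C (MvPolynomial.X i)
    have hz : ∀ i, MvPowerSeries.constantCoeff (z i) = 0 := fun i => by simp [z, hθ _]
    have hθz : θ = (MvPolynomial.aeval (fun i => MvPowerSeries.C (MvPolynomial.X i) + z i) :
        MvPolynomial (Fin n) A →ₐ[A]
          MvPowerSeries (Fin n) (MvPolynomial (Fin n) A)).toRingHom := by
      refine MvPolynomial.ringHom_ext (fun r => ?_) fun i => ?_
      · simp [hC, MvPolynomial.algebraMap_mvPowerSeries_apply]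
      · simp [z]
    have hzy : z = y := by
      refine MvPowerSeries.eq_of_forall_subst_eq h0 hJ' hz hy fun i => ?_
      have h1 := hθf (MvPolynomial.X i)
      rw [MvPolynomial.aeval_X, MvPolynomial.aeval_X, hθz] at h1
      rw [hfy, MvPolynomial.subst_increment f hz, sub_eq_iff_eq_add, add_comm]
      exact h1
    rw [hθz, hzy]

/-! ### Continuous extension to power series -/

namespace MvPowerSeries

theorem continuous_map {σ R S : Type*} [CommRing R] [CommRing S] [TopologicalSpace R]
    [TopologicalSpace S] {φ : R →+* S} (hφ : Continuous φ) :
    Continuous (map φ : MvPowerSeries σ R →+* MvPowerSeries σ S) :=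
  continuous_pi fun d => hφ.comp (WithPiTopology.continuous_coeff R d)

theorem eq_of_forall_coe_eq {σ R S : Type*} [CommRing R] [CommRing S] [TopologicalSpace R]
    [TopologicalSpace S] [T2Space S] {φ ψ : MvPowerSeries σ R →+* S}
    (hφ : Continuous φ) (hψ : Continuous ψ)
    (h : ∀ p : MvPolynomial σ R, φ (p : MvPowerSeries σ R) = ψ (p : MvPowerSeries σ R)) :
    φ = ψ :=
  DFunLike.coe_injective <|
    (WithPiTopology.denseRange_toMvPowerSeries (σ := σ) (R := R)).equalizer hφ hψ (funext h)

theorem continuous_subst_of_discreteTopology {σ τ R : Type*} [CommRing R] [t : TopologicalSpace R]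
    [DiscreteTopology R] {a : σ → MvPowerSeries τ R} (ha : HasSubst a) :
    Continuous (subst a : MvPowerSeries σ R → MvPowerSeries τ R) := by
  obtain rfl : t = ⊥ := DiscreteTopology.eq_bot
  let : UniformSpace R := ⊥
  exact continuous_subst ha

/-- Evaluation of power series over a discrete ring at power series in `T` over the power series
in `x` whose constant terms are the variables `x`. -/
theorem exists_continuous_ringHom_coe_eq_aeval {σ R : Type*} [Finite σ] [CommRing R]
    [t : TopologicalSpace R] [DiscreteTopology R] {u : σ → MvPowerSeries σ (MvPowerSeries σ R)}
    (hu : ∀ i, constantCoeff (u i) = X i) :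
    ∃ Θ : MvPowerSeries σ R →+* MvPowerSeries σ (MvPowerSeries σ R), Continuous Θ ∧
      ∀ p : MvPolynomial σ R, Θ (p : MvPowerSeries σ R) = MvPolynomial.aeval u p := by
  obtain rfl : t = ⊥ := DiscreteTopology.eq_bot
  let : UniformSpace R := ⊥
  have : ContinuousSMul R R := DiscreteTopology.instContinuousSMul R R
  have hev : HasEval u := by
    -- Topological nilpotency of `u i` is inherited from its constant term `X i`.
    refine ⟨fun i => LinearTopology.isTopologicallyNilpotent_of_constantCoeff ?_, ?_⟩
    · rw [hu]
      exact WithPiTopology.isTopologicallyNilpotent_of_constantCoeff_zero (constantCoeff_X i)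
    · rw [Filter.cofinite_eq_bot]
      exact Filter.tendsto_bot
  exact ⟨(aeval hev).toRingHom, continuous_aeval hev, fun p => aeval_coe hev p⟩

end MvPowerSeries

/-! ### Evaluation at the origin and the main theorem -/

theorem map_constantCoeff_aeval_C_add_X {σ A : Type*} [CommRing A] {f : σ → MvPolynomial σ A}
    (h0 : ∀ j, MvPolynomial.constantCoeff (f j) = 0) (p : MvPolynomial σ A) :
    MvPowerSeries.map (MvPowerSeries.constantCoeff (σ := σ) (R := A))
      (MvPowerSeries.map MvPolynomial.coeToMvPowerSeries.ringHom
        (MvPolynomial.aeval (fun i => (MvPowerSeries.C (f i) + MvPowerSeries.X i :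
          MvPowerSeries σ (MvPolynomial σ A))) p)) = (p : MvPowerSeries σ A) := by
  have hc : ∀ q : MvPolynomial σ A, MvPowerSeries.constantCoeff (q : MvPowerSeries σ A) =
      MvPolynomial.constantCoeff q := fun q => by
    rw [← MvPowerSeries.coeff_zero_eq_constantCoeff_apply, MvPolynomial.coeff_coe,
      MvPolynomial.constantCoeff_eq]
  induction p using MvPolynomial.induction_on with
  | C a => simp [MvPolynomial.algebraMap_mvPowerSeries_apply]
  | add p q hp hq => simp only [map_add, hp, hq, MvPolynomial.coe_add]
  | mul_X p i hp =>
    rw [map_mul, map_mul, map_mul, hp]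
    simp [hc, h0]

theorem theorem5p1 {A : Type*} [CommRing A] [TopologicalSpace A] [DiscreteTopology A] {n : ℕ}
    (F : MvPolynomial (Fin n) A →ₐ[A] MvPolynomial (Fin n) A)
    (hJ : IsUnit (jacobianMatrix fun j => F (MvPolynomial.X j)).det)
    (h0 : ∀ j, MvPolynomial.constantCoeff (F (MvPolynomial.X j)) = 0) :
    -- the higher derivation `θ_f` on `A[x]`
    ∃ θ : MvPolynomial (Fin n) A →+* MvPowerSeries (Fin n) (MvPolynomial (Fin n) A),
      ExtendsHigherDerivationWrt (fun j => F (MvPolynomial.X j)) θ ∧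
      (∀ θ', ExtendsHigherDerivationWrt (fun j => F (MvPolynomial.X j)) θ' → θ' = θ) ∧
    -- its continuous extension to `A[[x]]`
    ∃ Θ : MvPowerSeries (Fin n) A →+* MvPowerSeries (Fin n) (MvPowerSeries (Fin n) A),
      IsContinuousExtensionHD θ Θ ∧
      (∀ Θ', IsContinuousExtensionHD θ Θ' → Θ' = Θ) ∧
      IsHigherDerivation Θ ∧
    -- the continuous extension of `F` to `A[[x]]`, an automorphism
    ∃ Φ : MvPowerSeries (Fin n) A ≃ₐ[A] MvPowerSeries (Fin n) A,
      IsContinuousExtensionEnd F (Φ : MvPowerSeries (Fin n) A →+* MvPowerSeries (Fin n) A) ∧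
      (∀ Φ', IsContinuousExtensionEnd F Φ' →
        Φ' = (Φ : MvPowerSeries (Fin n) A →+* MvPowerSeries (Fin n) A)) ∧
    -- its inverse: evaluate `θ_f(h)` at `x = 0`, then at `T = x`; and the same as a series
      ∀ h : MvPowerSeries (Fin n) A,
        Φ.symm h =
          MvPowerSeries.subst (MvPowerSeries.X : Fin n → MvPowerSeries (Fin n) A)
            (MvPowerSeries.map (MvPowerSeries.constantCoeff (σ := Fin n) (R := A)) (Θ h)) ∧
        HasSum
          (fun μ : Fin n →₀ ℕ =>
            MvPowerSeries.C (MvPowerSeries.constantCoeff (MvPowerSeries.coeff μ (Θ h))) *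
              ∏ i, (MvPowerSeries.X i : MvPowerSeries (Fin n) A) ^ μ i)
          (Φ.symm h) := by
  set f : Fin n → MvPolynomial (Fin n) A := fun j => F (MvPolynomial.X j) with hf
  have hF : F = MvPolynomial.aeval f := MvPolynomial.aeval_unique F
  obtain ⟨u, hu, huniq⟩ := exists_unique_extendsHigherDerivationWrt f hJ
  refine ⟨_, hu, huniq, ?_⟩
  have huX : ∀ i, MvPowerSeries.constantCoeff (u i) = MvPolynomial.X i := fun i => by
    simpa using hu.1 (MvPolynomial.X i)
  -- the extension of the higher derivation
  obtain ⟨Θ, hΘc, hΘu⟩ := MvPowerSeries.exists_continuous_ringHom_coe_eq_aeval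
    (u := fun i => MvPowerSeries.map MvPolynomial.coeToMvPowerSeries.ringHom (u i))
    (fun i => by simp [MvPowerSeries.constantCoeff_map, huX])
  have hΘ : ∀ p : MvPolynomial (Fin n) A, Θ (p : MvPowerSeries (Fin n) A) =
      MvPowerSeries.map MvPolynomial.coeToMvPowerSeries.ringHom (MvPolynomial.aeval u p) := by
    intro p
    rw [hΘu]
    induction p using MvPolynomial.induction_on with
    | C a => simp [MvPowerSeries.algebraMap_apply]
    | add p q hp hq => simp only [map_add, hp, hq]
    | mul_X p i hp => simp only [map_mul, hp, MvPolynomial.aeval_X]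
  refine ⟨Θ, ⟨hΘc, hΘ⟩, fun Θ' h' => MvPowerSeries.eq_of_forall_coe_eq h'.1 hΘc fun p =>
    (h'.2 p).trans (hΘ p).symm, ?_, ?_⟩
  -- Setting `T = 0` after `Θ` is continuous and the identity on polynomials.
  · refine fun h => RingHom.congr_fun (MvPowerSeries.eq_of_forall_coe_eq
      (φ := MvPowerSeries.constantCoeff.comp Θ) (ψ := RingHom.id _)
      ((MvPowerSeries.WithPiTopology.continuous_constantCoeff _).comp hΘc) continuous_id
      fun p => ?_) h
    rw [RingHom.comp_apply, hΘ, MvPowerSeries.constantCoeff_map]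
    exact congrArg _ (hu.1 p)
  -- the extension of the endomorphism
  have hf0 : ∀ i, MvPowerSeries.constantCoeff (f i : MvPowerSeries (Fin n) A) = 0 := fun i => by
    rw [← MvPowerSeries.coeff_zero_eq_constantCoeff_apply, MvPolynomial.coeff_coe,
      ← MvPolynomial.constantCoeff_eq, h0]
  have hfs := MvPowerSeries.hasSubst_of_constantCoeff_zero hf0
  have hdet : IsUnit (MvPowerSeries.linearMatrix
      fun i => (f i : MvPowerSeries (Fin n) A)).det := by
    rw [MvPolynomial.linearMatrix_coe]
    have := hJ.map (MvPolynomial.constantCoeff (σ := Fin n) (R := A))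
    rwa [RingHom.map_det] at this
  let Φ : MvPowerSeries (Fin n) A ≃ₐ[A] MvPowerSeries (Fin n) A :=
    AlgEquiv.ofBijective (MvPowerSeries.substAlgHom hfs) (by
      rw [MvPowerSeries.coe_substAlgHom]
      exact MvPowerSeries.bijective_subst hf0 hdet)
  have hΦ : ∀ h, Φ h = MvPowerSeries.subst (fun i => (f i : MvPowerSeries (Fin n) A)) h :=
    fun h => by rw [← MvPowerSeries.coe_substAlgHom hfs]; rfl
  have hΦc : Continuous Φ := by
    rw [funext hΦ]
    exact MvPowerSeries.continuous_subst_of_discreteTopology hfs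
  have hΦF : ∀ p : MvPolynomial (Fin n) A, Φ (p : MvPowerSeries (Fin n) A) =
      (F p : MvPowerSeries (Fin n) A) := by
    intro p
    rw [hΦ, MvPowerSeries.subst_coe, hF]
    induction p using MvPolynomial.induction_on with
    | C a => simp [MvPowerSeries.algebraMap_apply]
    | add p q hp hq => simp only [map_add, hp, hq, MvPolynomial.coe_add]
    | mul_X p i hp => simp only [map_mul, hp, MvPolynomial.aeval_X, MvPolynomial.coe_mul]
  refine ⟨Φ, ⟨hΦc, hΦF⟩, fun Φ' h' => MvPowerSeries.eq_of_forall_coe_eq h'.1 hΦc fun p =>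
    (h'.2 p).trans (hΦF p).symm, fun h => ?_⟩
  -- the inverse
  have hE : ((MvPowerSeries.map MvPowerSeries.constantCoeff).comp Θ).comp
      (Φ : MvPowerSeries (Fin n) A →+* MvPowerSeries (Fin n) A) = RingHom.id _ := by
    -- By density it suffices to follow a polynomial: `p ↦ p(f) ↦ p(f + T) ↦ p(T)`, as `f` vanishes
    -- at `x = 0`.
    refine MvPowerSeries.eq_of_forall_coe_eq ?_ continuous_id fun p => ?_
    · exact ((MvPowerSeries.continuous_map
        (MvPowerSeries.WithPiTopology.continuous_constantCoeff A)).comp hΘc).comp hΦc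
    · have hup : MvPolynomial.aeval u (MvPolynomial.aeval f p) = _ := hu.2 p
      change MvPowerSeries.map MvPowerSeries.constantCoeff (Θ (Φ p)) = _
      rw [hΦF, hΘ, hF, hup]
      exact map_constantCoeff_aeval_C_add_X h0 p
  have hsymm : MvPowerSeries.map MvPowerSeries.constantCoeff (Θ h) = Φ.symm h := by
    simpa using RingHom.congr_fun hE (Φ.symm h)
  -- `T` and `x` share the index type `Fin n`, so setting `T = x` is the identity substitution.
  refine ⟨by rw [hsymm, MvPowerSeries.subst_self, id], ?_⟩
  convert! MvPowerSeries.WithPiTopology.hasSum_of_monomials_self (Φ.symm h) using 2 with μ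
  rw [← hsymm, MvPowerSeries.coeff_map, MvPowerSeries.monomial_eq', Finsupp.prod_fintype]
  · simp
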